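/- Let $T$ be an arbitrary index set and let $\mathbb{R}^T$ carry its product (cylindrical) $\sigma$-algebra. Let $\chi:\mathbb{R}\to\mathbb{R}$ be a cutoff function, i.e. bounded and measurable with $\chi(v)=1+o(|v|)$ as $v\to0$ and $\chi(v)=O(|v|^{-1})$ as $|v|\to\infty$. Let $\nu$ be a Lévy measure on $\mathbb{R}^T$, i.e. a measure with $\int \min(|x(t)|^2,1)\,\nu(dx)<\infty$ for every $t\in T$ and with $\nu(A)=\nu_*(A\setminus\{0\})$ for every measurable $A$, where $\nu_*$ is the inner measure. Let $(S,\mathcal S,n)$ be a $\sigma$-finite measure space and let $V=(V_t)_{t\in T}$ be a representation of $\nu$ on it, i.e. a family of measurable functions $V_t:S\to\mathbb{R}$ such that $n\{s: (V_t(s))_{t\in I}\in B\}=\nu\{x:(x(t))_{t\in I}\in B\}$ for every finite nonempty $I\subset T$ and every Borel set $B\subset\mathbb{R}^I$ with $0\notin B$. On a probability space, let $N$ be a Poisson random measure on $(S,\mathcal S)$ with intensity $n$, let $G=(G_t)_{t\in T}$ be a centered Gaussian process independent of $N$, let $b:T\to\mathbb{R}$, and let $X=(X_t)_{t\in T}$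 be a process such that for every $t\in T$, almost surely, $$X_t=G_t+\int_S V_t(s)\,\big[N(ds)-\chi(V_t(s))\,n(ds)\big]+b(t).$$ Here, for measurable $f:S\to\mathbb{R}$ with $\int\min(f^2,1)\,dn<\infty$, the integral $\int_S f\,[dN-\chi(f)\,dn]$ is the limit in probability, as $\varepsilon\downarrow0$, of $\int_{\{|f|>\varepsilon\}} f\,dN-\int_{\{|f|>\varepsilon\}}f\,\chi(f)\,dn$. (Thus $X$ is an infinitely divisible process with Lévy measure $\nu$.) Let $q:S\to[0,\infty)$ be measurable with $\int_S q\,dn=1$ and put $N(q)=\int_S q(s)\,N(ds)$. Then for every measurable $F:\mathbb{R}^T\to\mathbb{R}$, $$\int_S \mathbb{E}\big[F\big((X_t+V_t(s))_{t\in T}\big)\big]\,q(s)\,n(ds)=\mathbb{E}\big[F(X)\,N(q)\big].\qquad(1)$$ Conversely, for every such $F$, $$\mathbb{E}\big[F(X)\,\mathbf 1_{\{N(q)>0\}}\big]=\int_S\mathbb{E}\big[F\big((X_t+V_t(s))_{t\in T}\big)\,(N(q)+q(s))^{-1}\big]\,q(s)\,n(ds),\qquad(2)$$ and if $n\{s:q(s)>0\}=\infty$,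 then $$\mathbb{E}\big[F(X)\big]=\int_S\mathbb{E}\big[F\big((X_t+V_t(s))_{t\in T}\big)\,(N(q)+q(s))^{-1}\big]\,q(s)\,n(ds).\qquad(3)$$ The convention $0\cdot\infty=0$ is used. Each identity means: if one side exists then so does the other, and they are equal. That is, for measurable $F:\mathbb{R}^T\to[0,\infty]$ both sides are equal as elements of $[0,\infty]$; and for real-valued $F$ the integrand on one side is integrable if and only if the integrand on the other side is (with respect to the product of $n$ and the probability measure on the sides that involve $s$), and in that case both sides are equal. -/

import Mathlib

open MeasureTheory ProbabilityTheory Filter Topology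
open scoped ENNReal NNReal

/-- A cutoff function: bounded, measurable, `χ v = 1 + o(|v|)` as `v → 0` and
`χ v = O(|v|⁻¹)` as `|v| → ∞`. -/
structure IsCutoff (χ : ℝ → ℝ) : Prop where
  measurable : Measurable χ
  bounded : ∃ C : ℝ, ∀ v, |χ v| ≤ C
  near_zero : (fun v => χ v - 1) =o[𝓝[≠] (0 : ℝ)] (fun v => |v|)
  near_infty : χ =O[cocompact ℝ] (fun v => |v|⁻¹)

/-- A Lévy measure on the path space `ℝ^T` with its cylindrical (product) σ-algebra. The second
condition says that `ν A` is the inner measure of `A \ {0}` for all measurable `A`. -/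
structure IsLevyMeasure {T : Type*} (ν : Measure (T → ℝ)) : Prop where
  lintegral_lt_top : ∀ t : T, ∫⁻ x, ENNReal.ofReal (min (|x t| ^ 2) 1) ∂ν < ∞
  inner : ∀ A : Set (T → ℝ), MeasurableSet A →
    ν A = ⨆ (B : Set (T → ℝ)) (_ : MeasurableSet B) (_ : B ⊆ A \ {0}), ν B

/-- `V = (V_t)` on the measure space `(S, n)` is a representation of the measure `ν` on `ℝ^T`: for
each nonempty finite `I ⊆ T` the image of `n` under `V_I` and the image of `ν` under the projection
to `ℝ^I` agree on the measurable sets that do not contain the origin. -/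
structure IsLevyRepresentation {T S : Type*} [MeasurableSpace S] (n : Measure S)
    (V : T → S → ℝ) (ν : Measure (T → ℝ)) : Prop where
  measurable : ∀ t, Measurable (V t)
  measure_eq : ∀ I : Finset T, I.Nonempty → ∀ B : Set (I → ℝ), MeasurableSet B →
    (0 : I → ℝ) ∉ B →
      n {s | (fun t : I => V t s) ∈ B} = ν {x | (fun t : I => x t) ∈ B}

/-- `N` is a Poisson random measure on `S` with intensity `n`, defined on `(Ω, P)`. Measurability
of `N` is with respect to the σ-algebra on measures generated by the evaluations at measurable
sets. -/
structure IsPoissonRandomMeasure {Ω S : Type*} [MeasurableSpace Ω] [MeasurableSpace S]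
    (P : Measure Ω) (n : Measure S) (N : Ω → Measure S) : Prop where
  measurable : Measurable N
  map_eq : ∀ A : Set S, MeasurableSet A → n A ≠ ∞ →
    P.map (fun ω => N ω A) = (poissonMeasure (n A).toNNReal).map (fun k : ℕ => (k : ℝ≥0∞))
  eq_top : ∀ A : Set S, MeasurableSet A → n A = ∞ → ∀ᵐ ω ∂P, N ω A = ∞
  indep : ∀ (k : ℕ) (A : Fin k → Set S), (∀ i, MeasurableSet (A i)) →
    Pairwise (fun i j => Disjoint (A i) (A j)) → iIndepFun (fun i ω => N ω (A i)) P

/-- `Y` is (a version of) the stochastic integral `∫ f(s) [N(ds) - χ(f(s)) n(ds)]`, for `f` with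
`∫ min(f², 1) dn < ∞`. The set `{ε < |f|}` has finite intensity, so both integrals below are
ordinary integrals (a.s.); the stochastic integral is their limit in probability as `ε ↓ 0`. -/
def IsCompensatedIntegral {Ω S : Type*} [MeasurableSpace Ω] [MeasurableSpace S]
    (P : Measure Ω) (n : Measure S) (N : Ω → Measure S) (χ : ℝ → ℝ) (f : S → ℝ) (Y : Ω → ℝ) :
    Prop :=
  TendstoInMeasure P
    (fun (ε : ℝ) (ω : Ω) =>
      (∫ s in {s | ε < |f s|}, f s ∂(N ω)) - ∫ s in {s | ε < |f s|}, f s * χ (f s) ∂n)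
    (𝓝[>] 0) Y

/-- `N(q) = ∫ q(s) N(ds)`, as an extended nonnegative random variable. -/
noncomputable def poissonSum {Ω S : Type*} [MeasurableSpace S]
    (N : Ω → Measure S) (q : S → ℝ≥0) (ω : Ω) : ℝ≥0∞ :=
  ∫⁻ s, (q s : ℝ≥0∞) ∂(N ω)

/-!
The identities express invariance of the Poisson random measure `N` under insertion of an atom.

*Mecke's formula*, `E[f(N) N(q)] = ∫ E[f(N + δ_s)] q(s) n(ds)`, is proved from the definition of a
Poisson random measure. For one Poisson variable `K` of mean `r` it is `E[φ(K) K] = r E[φ(K + 1)]`.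
Independence over disjoint sets gives it for functionals of the masses of the cells of a finite
partition, multiplied by the mass of one cell. Finitely many arbitrary sets are unions of cells of
the partition they generate, and the law of a random measure is determined by the joint laws of
finitely many evaluations; so the formula holds for all measurable `f`
(`IsPoissonRandomMeasure.mecke_set`) and, by independence and Fubini's theorem, with an additional
independent argument `G` (`IsPoissonRandomMeasure.mecke_indep`).

It remains to see that inserting an atom at `s` moves `X` by `V(s)`. Along a subsequence the
truncated integrals that define `Y_t` converge almost surely, so `Y_t = Λ_t(N)` for a measurable
functional `Λ_t` of measures; the atom at `s` changes the truncated integrals by `V_t(s)` as soon as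
`ε < |V_t(s)|`, while the compensators do not change, whence `Λ_t(N + δ_s) = Y_t + V_t(s)`
(`IsCompensatedIntegral.exists_functional`). These equalities hold almost surely for each `t`
separately, which suffices because a set of the product σ-algebra on `ℝ^T` depends on `X` only up
to such modifications (`ae_eq_comp_of_forall_ae_eq`).

Identity (1) is Mecke's formula for `F(X)`, and (2) is Mecke's formula for `F(X) N(q)⁻¹`, since
`N(q)` is almost surely finite; (3) follows because `N(q) > 0` almost surely when
`n{q > 0} = ∞`. For real `F`, the identities for `[0, ∞]`-valued functionals say that two
image measures on `ℝ^T` coincide, and integrability and integrals are transferred through them.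
-/

/-! ### The Poisson law -/
/-- The one-dimensional Mecke formula: `E[φ(K) K] = r E[φ(K + 1)]` for `K` Poisson of mean `r`. -/
theorem lintegral_mul_natCast_poissonMeasure (r : ℝ≥0) (φ : ℕ → ℝ≥0∞) :
    ∫⁻ k, φ k * k ∂(poissonMeasure r) = r * ∫⁻ k, φ (k + 1) ∂(poissonMeasure r) := by
  rw [lintegral_countable', lintegral_countable', tsum_eq_zero_add' ENNReal.summable,
    ← ENNReal.tsum_mul_left]
  simp only [Nat.cast_zero, mul_zero, zero_mul, zero_add, poissonMeasure_singleton]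
  refine tsum_congr fun k => ?_
  -- `(k + 1) P(K = k + 1) = r P(K = k)`
  have h : ((k + 1 : ℕ) : ℝ≥0∞)
        * ENNReal.ofReal (Real.exp (-r) * r ^ (k + 1) / (k + 1).factorial)
      = r * ENNReal.ofReal (Real.exp (-r) * r ^ k / k.factorial) := by
    rw [← ENNReal.ofReal_natCast, ← ENNReal.ofReal_coe_nnreal,
      ← ENNReal.ofReal_mul (by positivity), ← ENNReal.ofReal_mul (by positivity)]
    congr 1
    rw [Nat.factorial_succ]
    push_cast
    rw [pow_succ]
    field_simp
  rw [mul_assoc, h]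
  ring

/-- The one-dimensional Mecke formula in the presence of an independent variable `W`. -/
theorem lintegral_mul_self_of_map_eq_poisson {Ω E : Type*} [MeasurableSpace Ω] [MeasurableSpace E]
    {P : Measure Ω} [IsProbabilityMeasure P] {U : Ω → ℝ≥0∞} {W : Ω → E} (hU : Measurable U)
    (hW : Measurable W) (hUW : IndepFun U W P) {r : ℝ≥0}
    (hr : P.map U = (poissonMeasure r).map (fun k : ℕ => (k : ℝ≥0∞)))
    {g : ℝ≥0∞ × E → ℝ≥0∞} (hg : Measurable g) :
    ∫⁻ ω, g (U ω, W ω) * U ω ∂P = r * ∫⁻ ω, g (U ω + 1, W ω) ∂P := by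
  have law : ∀ f : ℝ≥0∞ × E → ℝ≥0∞, Measurable f → ∫⁻ ω, f (U ω, W ω) ∂P
      = ∫⁻ w, ∫⁻ k : ℕ, f (k, w) ∂(poissonMeasure r) ∂(P.map W) := by
    intro f hf
    rw [← lintegral_map (μ := P) hf (hU.prodMk hW),
      (indepFun_iff_map_prod_eq_prod_map_map hU.aemeasurable hW.aemeasurable).1 hUW,
      lintegral_prod_symm _ hf.aemeasurable]
    refine lintegral_congr fun w => ?_
    rw [hr, lintegral_map (by fun_prop) (by fun_prop)]
  rw [law (fun p => g p * p.1) (by fun_prop), law (fun p => g (p.1 + 1, p.2)) (by fun_prop),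
    ← lintegral_const_mul']
  · refine lintegral_congr fun w => ?_
    rw [lintegral_mul_natCast_poissonMeasure]
    simp
  · simp

/-! ### Mecke's formula -/

namespace IsPoissonRandomMeasure

variable {Ω S : Type*} [MeasurableSpace Ω] [MeasurableSpace S] {P : Measure Ω}
  {n : Measure S} {N : Ω → Measure S}

theorem measurable_apply (hN : IsPoissonRandomMeasure P n N) {A : Set S} (hA : MeasurableSet A) :
    Measurable fun ω => N ω A :=
  (Measure.measurable_coe hA).comp hN.measurable

theorem iIndepFun_apply (hN : IsPoissonRandomMeasure P n N) {J : Type*} [Finite J] {A : J → Set S}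
    (hA : ∀ j, MeasurableSet (A j)) (hd : Pairwise fun i j => Disjoint (A i) (A j)) :
    iIndepFun (fun j ω => N ω (A j)) P := by
  obtain ⟨k, ⟨e⟩⟩ := Finite.exists_equiv_fin J
  have h := hN.indep k (fun i => A (e.symm i)) (fun i => hA _)
    (fun i j hij => hd (e.symm.injective.ne hij))
  simpa using h.precomp e.injective

/-- Mecke's formula for functionals of the masses of disjoint sets, multiplied by the mass of one of
them. Infinite intensities are allowed for the other sets: only independence from them is used. -/
theorem mecke_cell [IsProbabilityMeasure P] (hN : IsPoissonRandomMeasure P n N) {J : Type*}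
    [Finite J] [DecidableEq J]
    {A : J → Set S} (hA : ∀ j, MeasurableSet (A j)) (hd : Pairwise fun i j => Disjoint (A i) (A j))
    {i : J} (hi : n (A i) ≠ ∞) {ψ : (J → ℝ≥0∞) → ℝ≥0∞} (hψ : Measurable ψ) :
    ∫⁻ ω, ψ (fun j => N ω (A j)) * N ω (A i) ∂P
      = n (A i) * ∫⁻ ω, ψ (fun j => N ω (A j) + if j = i then 1 else 0) ∂P := by
  have := Fintype.ofFinite J
  have hm := fun j => hN.measurable_apply (hA j)
  have ind := ((hN.iIndepFun_apply hA hd).indepFun_finset {i} {i}ᶜ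
    (disjoint_compl_right) hm).comp
    (measurable_pi_apply (⟨i, by simp⟩ : ({i} : Finset J))) measurable_id
  let g : ℝ≥0∞ × (({i}ᶜ : Finset J) → ℝ≥0∞) → ℝ≥0∞ :=
    fun p => ψ fun j => if h : j = i then p.1 else p.2 ⟨j, by simpa using h⟩
  have hg : Measurable g := by
    refine hψ.comp (measurable_pi_iff.2 fun j => ?_)
    by_cases h : j = i <;> simp only [h, dite_true, dite_false] <;> fun_prop
  have key := lintegral_mul_self_of_map_eq_poisson (hm i)
    (measurable_pi_iff.2 fun j : ({i}ᶜ : Finset J) => hm j) ind (hN.map_eq _ (hA i) hi) hg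
  rw [ENNReal.coe_toNNReal hi] at key
  convert key using 4 with ω ω
  · simp only [g]
    congr 1
    ext j
    split_ifs with h
    · rw [h]
    · rfl
  · simp only [g]
    congr 1
    ext j
    by_cases h : j = i
    · simp [h]
    · simp [h]

/-- Mecke's formula for functionals of the masses of finitely many, possibly overlapping, sets. -/
theorem mecke_finite [IsProbabilityMeasure P] (hN : IsPoissonRandomMeasure P n N) {I : Type*}
    [Finite I] {B : I → Set S} (hB : ∀ i, MeasurableSet (B i)) {A : Set S} (hA : MeasurableSet A)
    (hnA : n A ≠ ∞) {ψ : (I → ℝ≥0∞) → ℝ≥0∞} (hψ : Measurable ψ) :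
    ∫⁻ ω, ψ (fun i => N ω (B i)) * N ω A ∂P
      = ∫⁻ s in A, ∫⁻ ω, ψ (fun i => N ω (B i) + Measure.dirac s (B i)) ∂P ∂n := by
  classical
  -- `c s` records which of the sets `A`, `B i` contain `s`; its level sets `D j` are the cells of
  -- the partition generated by these sets, and `hun` and `hsum` decompose the sets into cells.
  let B' : Option I → Set S := fun o => o.elim A B
  have hB' : ∀ o, MeasurableSet (B' o) := by rintro (_ | i); exacts [hA, hB i]
  let J := Option I → Prop
  have := Fintype.ofFinite J
  let c : S → J := fun s o => s ∈ B' o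
  have hc : Measurable c := measurable_pi_iff.2 fun o => measurableSet_setOfPred.1 (hB' o)
  let D : J → Set S := fun j => c ⁻¹' {j}
  have hD : ∀ j, MeasurableSet (D j) := fun j => hc (measurableSet_singleton j)
  have hd : Pairwise fun i j => Disjoint (D i) (D j) := fun i j hij =>
    Disjoint.preimage c (by simpa using hij)
  have hun : ∀ o, B' o = ⋃ j ∈ (Finset.univ.filter fun j : J => j o), D j := by
    intro o
    ext s
    simp [D, c]
  have hsum : ∀ (μ : Measure S) (o : Option I),
      μ (B' o) = ∑ j ∈ Finset.univ.filter (fun j : J => j o), μ (D j) := by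
    intro μ o
    rw [hun o, measure_biUnion_finset (fun i _ j _ hij => hd hij) (fun j _ => hD j)]
  let ψ' : (J → ℝ≥0∞) → ℝ≥0∞ := fun x =>
    ψ fun i => ∑ j ∈ Finset.univ.filter (fun j : J => j (some i)), x j
  have hψ' : Measurable ψ' := by fun_prop
  have hsub : ∀ j ∈ Finset.univ.filter (fun j : J => j none), n (D j) ≠ ∞ := by
    intro j hj
    refine ne_top_of_le_ne_top hnA (measure_mono ?_)
    change _ ⊆ B' none
    rw [hun none]
    exact Set.subset_biUnion_of_mem (u := D) hj
  have hL : ∀ ω, ψ (fun i => N ω (B i)) * N ω A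
      = ∑ j ∈ Finset.univ.filter (fun j : J => j none), ψ' (fun j => N ω (D j)) * N ω (D j) := by
    intro ω
    rw [← Finset.mul_sum, ← hsum (N ω) none]
    simp only [ψ', ← hsum]
    rfl
  have hR : A = ⋃ j ∈ (Finset.univ.filter fun j : J => j none), D j := hun none
  simp_rw [hL]
  have hm := fun j => hN.measurable_apply (hD j)
  rw [lintegral_finsetSum _ fun j _ => by fun_prop, hR,
    lintegral_biUnion_finset (fun i _ j _ hij => hd hij) (fun j _ => hD j)]
  refine Finset.sum_congr rfl fun i hi => ?_
  rw [hN.mecke_cell hD hd (hsub i hi) hψ', mul_comm, ← setLIntegral_const]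
  refine setLIntegral_congr_fun (hD i) fun s hs => lintegral_congr fun ω => ?_
  have hs' : c s = i := hs
  have : ∀ j, (if j = i then (1 : ℝ≥0∞) else 0) = Measure.dirac s (D j) := by
    intro j
    rw [Measure.dirac_apply' _ (hD j)]
    simp [Set.indicator_apply, D, hs', eq_comm]
  simp only [this, ψ', Finset.sum_add_distrib, ← hsum]
  rfl

end IsPoissonRandomMeasure

/-- A law of random measures is determined by the joint laws of the masses of finitely many
measurable sets. -/
theorem ext_of_map_evaluations {S : Type*} [MeasurableSpace S] {α β : Measure (Measure S)}
    [IsFiniteMeasure β]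
    (h : ∀ I : Finset {B : Set S // MeasurableSet B},
      α.map (fun μ (i : I) => μ i.1.1) = β.map (fun μ (i : I) => μ i.1.1)) : α = β := by
  let e : Measure S → {B : Set S // MeasurableSet B} → ℝ≥0∞ := fun μ B => μ B.1
  have he : Measurable e := measurable_pi_iff.2 fun B => Measure.measurable_coe B.2
  have hlim : ∀ I : Finset {B : Set S // MeasurableSet B}, Measurable
      (I.restrict : ({B : Set S // MeasurableSet B} → ℝ≥0∞) → I → ℝ≥0∞) :=
    fun I => Finset.measurable_restrict I
  have hmap : α.map e = β.map e := by
    refine IsProjectiveLimit.unique (P := fun I => β.map (fun μ (i : I) => μ i.1.1)) ?_ ?_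
    · intro I
      rw [Measure.map_map (hlim I) he]
      exact h I
    · intro I
      rw [Measure.map_map (hlim I) he]
      rfl
  ext E hE
  -- the σ-algebra on measures is the one induced by the evaluation map `e`
  have hle : (Measure.instMeasurableSpace : MeasurableSpace (Measure S))
      ≤ MeasurableSpace.comap e inferInstance := by
    refine iSup₂_le fun B hB => ?_
    rintro _ ⟨C, hC, rfl⟩
    exact ⟨Function.eval ⟨B, hB⟩ ⁻¹' C, measurable_pi_apply _ hC, rfl⟩
  obtain ⟨E', hE', rfl⟩ := hle E hE
  rw [← Measure.map_apply he hE', hmap, Measure.map_apply he hE']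

namespace IsPoissonRandomMeasure

variable {Ω S : Type*} [MeasurableSpace Ω] [MeasurableSpace S] {P : Measure Ω}
  {n : Measure S} {N : Ω → Measure S}

theorem measurable_add_dirac (hN : IsPoissonRandomMeasure P n N) :
    Measurable fun p : S × Ω => N p.2 + Measure.dirac p.1 :=
  (hN.measurable.comp measurable_snd).add (Measure.measurable_dirac.comp measurable_fst)

/-- Mecke's formula for a general functional of `N` and the mass of a set of finite intensity: both
sides are the integrals of `f` against finite measures on the space of measures, which agree on
functionals of finitely many masses. -/
theorem mecke_set [IsProbabilityMeasure P] [SigmaFinite n] (hN : IsPoissonRandomMeasure P n N)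
    {A : Set S} (hA : MeasurableSet A) (hnA : n A ≠ ∞) {f : Measure S → ℝ≥0∞} (hf : Measurable f) :
    ∫⁻ ω, f (N ω) * N ω A ∂P = ∫⁻ s in A, ∫⁻ ω, f (N ω + Measure.dirac s) ∂P ∂n := by
  let α : Measure (Measure S) := (P.withDensity fun ω => N ω A).map N
  let β : Measure (Measure S) :=
    ((n.restrict A).prod P).map fun p => N p.2 + Measure.dirac p.1
  have hNA := hN.measurable_apply hA
  have hadd := hN.measurable_add_dirac
  have hα : ∀ g : Measure S → ℝ≥0∞, Measurable g →
      ∫⁻ μ, g μ ∂α = ∫⁻ ω, g (N ω) * N ω A ∂P := by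
    intro g hg
    have hgN : Measurable fun ω => g (N ω) := hg.comp hN.measurable
    rw [lintegral_map hg hN.measurable, lintegral_withDensity_eq_lintegral_mul _ hNA hgN]
    simp only [Pi.mul_apply, mul_comm]
  have hβ : ∀ g : Measure S → ℝ≥0∞, Measurable g →
      ∫⁻ μ, g μ ∂β = ∫⁻ s in A, ∫⁻ ω, g (N ω + Measure.dirac s) ∂P ∂n := by
    intro g hg
    rw [lintegral_map hg hadd]
    exact lintegral_prod _ (hg.comp hadd).aemeasurable
  have : IsFiniteMeasure β := ⟨by
    rw [← lintegral_one, hβ _ measurable_const]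
    simpa using hnA.lt_top⟩
  have hαβ : α = β := by
    refine ext_of_map_evaluations fun I => Measure.ext_of_lintegral _ fun ψ hψ => ?_
    have hm : Measurable fun (μ : Measure S) (i : I) => μ i.1.1 :=
      measurable_pi_iff.2 fun i => Measure.measurable_coe i.1.2
    rw [lintegral_map hψ hm, lintegral_map hψ hm]
    refine (hα _ (hψ.comp hm)).trans (Eq.trans ?_ (hβ _ (hψ.comp hm)).symm)
    exact hN.mecke_finite (fun i : I => i.1.2) hA hnA hψ
  rw [← hα f hf, hαβ, hβ f hf]

/-- Mecke's formula for a functional of `N` and of a variable `G` independent of `N`. -/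
theorem mecke_indep [IsProbabilityMeasure P] [SigmaFinite n] (hN : IsPoissonRandomMeasure P n N)
    {E : Type*} [MeasurableSpace E] {G : Ω → E} (hG : Measurable G) (hGN : IndepFun G N P)
    {f : E × Measure S → ℝ≥0∞} (hf : Measurable f) {q : S → ℝ≥0∞} (hq : Measurable q) :
    ∫⁻ ω, f (G ω, N ω) * ∫⁻ s, q s ∂(N ω) ∂P
      = ∫⁻ s, (∫⁻ ω, f (G ω, N ω + Measure.dirac s) ∂P) * q s ∂n := by
  have hNm := hN.measurable
  have hGNm : Measurable fun ω => (G ω, N ω) := hG.prodMk hNm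
  have hadd := hN.measurable_add_dirac
  have law : ∀ g : E × Measure S → ℝ≥0∞, Measurable g →
      ∫⁻ ω, g (G ω, N ω) ∂P = ∫⁻ ω', ∫⁻ ω, g (G ω', N ω) ∂P ∂P := by
    intro g hg
    rw [← lintegral_map (μ := P) hg hGNm,
      (indepFun_iff_map_prod_eq_prod_map_map hG.aemeasurable hNm.aemeasurable).1 hGN,
      lintegral_prod _ hg.aemeasurable, lintegral_map hg.lintegral_prod_right' hG]
    exact lintegral_congr fun ω' => lintegral_map (by fun_prop) hNm
  have hfGN : Measurable fun ω => f (G ω, N ω) := hf.comp hGNm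
  have hqN : Measurable fun ω => ∫⁻ s, q s ∂(N ω) := (Measure.measurable_lintegral hq).comp hNm
  have hshift : Measurable fun p : S × Ω => f (G p.2, N p.2 + Measure.dirac p.1) :=
    hf.comp ((hG.comp measurable_snd).prodMk hadd)
  have hset : ∀ A, MeasurableSet A → n A ≠ ∞ → ∫⁻ ω, f (G ω, N ω) * N ω A ∂P
      = ∫⁻ s in A, ∫⁻ ω, f (G ω, N ω + Measure.dirac s) ∂P ∂n := by
    intro A hA hnA
    have hmA : Measurable fun p : E × Measure S => p.2 A :=
      (Measure.measurable_coe hA).comp measurable_snd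
    rw [law (fun p => f p * p.2 A) (hf.mul hmA)]
    have h1 : ∀ ω', ∫⁻ ω, f (G ω', N ω) * N ω A ∂P
        = ∫⁻ s in A, ∫⁻ ω, f (G ω', N ω + Measure.dirac s) ∂P ∂n := fun ω' =>
      hN.mecke_set (f := fun μ => f (G ω', μ)) hA hnA (by fun_prop)
    simp_rw [h1]
    have hm3 : Measurable fun x : (Ω × S) × Ω => f (G x.1.1, N x.2 + Measure.dirac x.1.2) :=
      hf.comp ((hG.comp (measurable_fst.comp measurable_fst)).prodMk
        (hadd.comp ((measurable_snd.comp measurable_fst).prodMk measurable_snd)))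
    rw [lintegral_lintegral_swap (f := fun ω' s => ∫⁻ ω, f (G ω', N ω + Measure.dirac s) ∂P)
      hm3.lintegral_prod_right'.aemeasurable]
    refine lintegral_congr fun s => ?_
    exact (law (fun p => f (p.1, p.2 + Measure.dirac s)) (by fun_prop)).symm
  -- as functions of `A`, both sides of `hset` are measures; `q` is integrated against them
  have hmeas : (P.withDensity fun ω => f (G ω, N ω)).bind N
      = n.withDensity fun s => ∫⁻ ω, f (G ω, N ω + Measure.dirac s) ∂P := by
    refine (Measure.ext_iff_of_iUnion_eq_univ (iUnion_spanningSets n)).2 fun i => ?_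
    ext A hA
    have hAi := hA.inter (measurableSet_spanningSets n i)
    rw [Measure.restrict_apply hA, Measure.restrict_apply hA,
      Measure.bind_apply hAi hNm.aemeasurable, withDensity_apply _ hAi,
      lintegral_withDensity_eq_lintegral_mul _ hfGN (hN.measurable_apply hAi)]
    exact hset _ hAi (ne_top_of_le_ne_top (measure_spanningSets_lt_top n i).ne
      (measure_mono Set.inter_subset_right))
  have h := congrArg (fun m : Measure S => ∫⁻ s, q s ∂m) hmeas
  beta_reduce at h
  rw [Measure.lintegral_bind hNm.aemeasurable hq.aemeasurable,
    lintegral_withDensity_eq_lintegral_mul _ hfGN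
      hqN,
    lintegral_withDensity_eq_lintegral_mul _ hshift.lintegral_prod_right' hq] at h
  exact h

/-- Campbell's formula `E[N(q)] = ∫ q dn`, as Mecke's formula for the constant functional. -/
theorem lintegral_lintegral [IsProbabilityMeasure P] [SigmaFinite n]
    (hN : IsPoissonRandomMeasure P n N) {q : S → ℝ≥0∞} (hq : Measurable q) :
    ∫⁻ ω, ∫⁻ s, q s ∂(N ω) ∂P = ∫⁻ s, q s ∂n := by
  have h := hN.mecke_indep (G := fun _ => ()) measurable_const (indepFun_const_left _ _)
    (f := fun _ => 1) measurable_const hq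
  simpa using h

theorem ae_exists_natCast (hN : IsPoissonRandomMeasure P n N) {A : Set S} (hA : MeasurableSet A)
    (hnA : n A ≠ ∞) : ∀ᵐ ω ∂P, ∃ k : ℕ, N ω A = k := by
  have hs : MeasurableSet {x : ℝ≥0∞ | ∃ k : ℕ, x = k} := by
    have : {x : ℝ≥0∞ | ∃ k : ℕ, x = k} = Set.range fun k : ℕ => (k : ℝ≥0∞) := by
      ext x; simp [eq_comm]
    rw [this]
    exact (Set.countable_range _).measurableSet
  rw [← ae_map_iff (p := fun x : ℝ≥0∞ => ∃ k : ℕ, x = k) (hN.measurable_apply hA).aemeasurable hs,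
    hN.map_eq A hA hnA, ae_map_iff (by fun_prop) hs]
  exact ae_of_all _ fun k => ⟨k, rfl⟩

end IsPoissonRandomMeasure

/-! ### Modifications of processes -/

theorem Measurable.ae_eq_comp_of_ae_mem_iff {Ω E : Type*} [MeasurableSpace Ω] [MeasurableSpace E]
    {P : Measure Ω} {U U' : Ω → E}
    (h : ∀ A, MeasurableSet A → ∀ᵐ ω ∂P, U ω ∈ A ↔ U' ω ∈ A) {H : E → ℝ≥0∞} (hH : Measurable H) :
    ∀ᵐ ω ∂P, H (U ω) = H (U' ω) := by
  refine Measurable.ennreal_induction (motive := fun H => ∀ᵐ ω ∂P, H (U ω) = H (U' ω)) ?_ ?_ ?_ hH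
  · intro c A hA
    classical
    filter_upwards [h A hA] with ω hω
    simp only [Set.indicator_apply, hω]
  · intro f g _ _ _ hf hg
    filter_upwards [hf, hg] with ω h1 h2
    simp only [Pi.add_apply, h1, h2]
  · intro f _ _ hf
    filter_upwards [ae_all_iff.2 hf] with ω hω
    simp only [hω]

/-- If `X t = X' t` almost surely for each `t`, then `H(X, W) = H(X', W)` almost surely, even for an
uncountable index set `T`: the sets `A` for which `{(X, W) ∈ A}` and `{(X', W) ∈ A}` agree up to a
null set form a σ-algebra, and it contains the generators of the product σ-algebra. -/
theorem ae_eq_comp_of_forall_ae_eq {Ω T E : Type*} [MeasurableSpace Ω] [MeasurableSpace E]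
    {P : Measure Ω} {X X' : Ω → T → ℝ} (hX : ∀ t, ∀ᵐ ω ∂P, X ω t = X' ω t) (W : Ω → E)
    {H : (T → ℝ) × E → ℝ≥0∞} (hH : Measurable H) :
    ∀ᵐ ω ∂P, H (X ω, W ω) = H (X' ω, W ω) := by
  refine Measurable.ae_eq_comp_of_ae_mem_iff (U := fun ω => (X ω, W ω))
    (U' := fun ω => (X' ω, W ω)) (fun A hA => ?_) hH
  let m : MeasurableSpace ((T → ℝ) × E) :=
    { MeasurableSet' := fun A => ∀ᵐ ω ∂P, (X ω, W ω) ∈ A ↔ (X' ω, W ω) ∈ A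
      measurableSet_empty := by simp
      measurableSet_compl := fun A hA => by
        filter_upwards [hA] with ω hω
        simp only [Set.mem_compl_iff, hω]
      measurableSet_iUnion := fun f hf => by
        filter_upwards [ae_all_iff.2 hf] with ω hω
        simp only [Set.mem_iUnion, hω] }
  have hm : (Prod.instMeasurableSpace : MeasurableSpace ((T → ℝ) × E)) ≤ m := by
    refine (sup_le ?_ ?_ : MeasurableSpace.comap Prod.fst MeasurableSpace.pi
      ⊔ MeasurableSpace.comap Prod.snd inferInstance ≤ m)
    · rintro _ ⟨B, hB, rfl⟩
      have hle : (MeasurableSpace.pi : MeasurableSpace (T → ℝ)) ≤ m.map Prod.fst := by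
        refine iSup_le fun t => ?_
        rintro _ ⟨C, _, rfl⟩
        change ∀ᵐ ω ∂P, _
        filter_upwards [hX t] with ω hω
        simp [hω]
      exact hle B hB
    · rintro _ ⟨B, _, rfl⟩
      exact ae_of_all _ fun ω => Iff.rfl
  exact hm A hA

/-! ### The compensated integral as a functional of the random measure -/

/-- The Bochner integral is a measurable function of the measure. Its value is `0` on the measurable
set of measures for which `g` is not integrable. -/
theorem measurable_integral_of_measure {S : Type*} [MeasurableSpace S] {g : S → ℝ}
    (hg : Measurable g) : Measurable fun μ : Measure S => ∫ s, g s ∂μ := by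
  have h : (fun μ : Measure S => ∫ s, g s ∂μ)
      = {μ : Measure S | ∫⁻ s, ‖g s‖ₑ ∂μ < ∞}.indicator fun μ =>
        (∫⁻ s, ENNReal.ofReal (g s) ∂μ).toReal - (∫⁻ s, ENNReal.ofReal (-g s) ∂μ).toReal := by
    ext μ
    by_cases hμ : ∫⁻ s, ‖g s‖ₑ ∂μ < ∞
    · rw [Set.indicator_of_mem (by exact hμ), integral_eq_lintegral_pos_part_sub_lintegral_neg_part
        ⟨hg.aestronglyMeasurable, hμ⟩]
    · rw [Set.indicator_of_notMem (by exact hμ), integral_undef fun hi => hμ hi.2]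
  rw [h]
  exact ((Measure.measurable_lintegral (by fun_prop)).ennreal_toReal.sub
    (Measure.measurable_lintegral (by fun_prop)).ennreal_toReal).indicator
    (measurableSet_lt (Measure.measurable_lintegral (by fun_prop)) measurable_const)

/-- Almost surely `f` is `N`-integrable on `{ε < |f|}`. The masses `N{ε + k < |f|}` decrease to `0`
and are integers, so `f` is `N`-essentially bounded on this set of finite mass. -/
theorem IsPoissonRandomMeasure.ae_integrableOn {Ω S : Type*} [MeasurableSpace Ω]
    [MeasurableSpace S] {P : Measure Ω} {n : Measure S} {N : Ω → Measure S}
    (hN : IsPoissonRandomMeasure P n N) {f : S → ℝ} (hf : Measurable f) {ε : ℝ}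
    (hn : n {s | ε < |f s|} ≠ ∞) : ∀ᵐ ω ∂P, IntegrableOn f {s | ε < |f s|} (N ω) := by
  let A : ℕ → Set S := fun k => {s | ε + k < |f s|}
  have hA : ∀ k, MeasurableSet (A k) := fun k => measurableSet_lt measurable_const hf.abs
  have hanti : Antitone A := fun k l hkl s (hs : ε + l < |f s|) => by
    have : (k : ℝ) ≤ l := by exact_mod_cast hkl
    change ε + k < |f s|
    linarith
  have hA0 : A 0 = {s | ε < |f s|} := by simp [A]
  have hinter : ⋂ k, A k = ∅ := by
    refine Set.eq_empty_of_forall_notMem fun s hs => ?_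
    obtain ⟨k, hk⟩ := exists_nat_gt (|f s| - ε)
    have : ε + k < |f s| := Set.mem_iInter.1 hs k
    linarith
  have hnA : ∀ k, n (A k) ≠ ∞ := fun k =>
    ne_top_of_le_ne_top hn (hA0 ▸ measure_mono (hanti (Nat.zero_le k)))
  filter_upwards [ae_all_iff.2 fun k => hN.ae_exists_natCast (hA k) (hnA k)] with ω hω
  have hfin : ∀ k, N ω (A k) ≠ ∞ := fun k => by
    obtain ⟨m, hm⟩ := hω k
    simp [hm]
  have hlim := tendsto_measure_iInter_atTop (μ := N ω) (fun k => (hA k).nullMeasurableSet) hanti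
    ⟨0, hfin 0⟩
  rw [hinter, measure_empty] at hlim
  obtain ⟨k, hk⟩ := (hlim.eventually_lt_const one_pos).exists
  have hk0 : N ω (A k) = 0 := by
    obtain ⟨m, hm⟩ := hω k
    rw [Function.comp_apply, hm] at hk
    rw [hm]
    exact_mod_cast Nat.lt_one_iff.1 (by exact_mod_cast hk)
  refine Measure.integrableOn_of_bounded (M := ε + k) (hA0 ▸ hfin 0) hf.aestronglyMeasurable
    (ae_restrict_of_ae ?_)
  filter_upwards [measure_eq_zero_iff_ae_notMem.1 hk0] with s hs
  exact not_lt.1 hs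

/-- The compensated integral of `f` is a measurable functional `Λ` of the random measure, and
inserting an atom at `s` raises it by `f s`, for almost every `ω` and all `s` simultaneously. -/
theorem IsCompensatedIntegral.exists_functional {Ω S : Type*} [MeasurableSpace Ω]
    [MeasurableSpace S] {P : Measure Ω} {n : Measure S} {N : Ω → Measure S}
    (hN : IsPoissonRandomMeasure P n N) {χ : ℝ → ℝ} {f : S → ℝ} {Y : Ω → ℝ}
    (hY : IsCompensatedIntegral P n N χ f Y) (hf : Measurable f)
    (hn : ∀ ε : ℝ, 0 < ε → n {s | ε < |f s|} ≠ ∞) :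
    ∃ Λ : Measure S → ℝ, Measurable Λ ∧ (∀ᵐ ω ∂P, Λ (N ω) = Y ω) ∧
      ∀ᵐ ω ∂P, ∀ s, Λ (N ω + Measure.dirac s) = Y ω + f s := by
  obtain ⟨u, hu, hlim⟩ := TendstoInMeasure.exists_seq_tendsto_ae' hY
  have hpos : ∀ᶠ k in atTop, 0 < u k := hu.eventually self_mem_nhdsWithin
  have hu0 : Tendsto u atTop (𝓝 0) := tendsto_nhds_of_tendsto_nhdsWithin hu
  have hset : ∀ ε : ℝ, MeasurableSet {s | ε < |f s|} := fun ε =>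
    measurableSet_lt measurable_const hf.abs
  refine ⟨fun μ => limsup (fun k => (∫ s in {s | u k < |f s|}, f s ∂μ)
    - ∫ s in {s | u k < |f s|}, f s * χ (f s) ∂n) atTop, ?_, ?_, ?_⟩
  · refine Measurable.limsup fun k => Measurable.sub_const ?_ _
    simp_rw [← integral_indicator (hset (u k))]
    exact measurable_integral_of_measure (hf.indicator (hset _))
  · filter_upwards [hlim] with ω hω
    exact hω.limsup_eq
  · have hint : ∀ᵐ ω ∂P, ∀ k, 0 < u k → IntegrableOn f {s | u k < |f s|} (N ω) :=
      ae_all_iff.2 fun k => by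
        by_cases hk : 0 < u k
        · filter_upwards [hN.ae_integrableOn hf (hn _ hk)] with ω hω _ using hω
        · exact ae_of_all _ fun ω h => absurd h hk
    filter_upwards [hlim, hint] with ω hω hi s
    -- the atom at `s` contributes `f s` to the `k`-th truncated integral once `u k < |f s|`
    have hjump : Tendsto (fun k => if u k < |f s| then f s else 0) atTop (𝓝 (f s)) := by
      refine tendsto_const_nhds.congr' ?_
      by_cases hs : f s = 0
      · simp [hs]
      · filter_upwards [hu0.eventually_lt_const (abs_pos.2 hs)] with k hk
        rw [if_pos hk]
    refine ((hω.add hjump).congr' ?_).limsup_eq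
    filter_upwards [hpos] with k hk
    have hδ : IntegrableOn f {s | u k < |f s|} (Measure.dirac s) :=
      (integrable_dirac' hf.stronglyMeasurable (by simp)).integrableOn
    rw [Measure.restrict_add, integral_add_measure (hi k hk) hδ,
      setIntegral_dirac' hf.stronglyMeasurable s (hset _)]
    simp only [Set.mem_ofPred_eq]
    ring

/-- The sets `{ε < |V t|}` have finite intensity, by Markov's inequality for the Lévy measure. -/
theorem IsLevyRepresentation.measure_lt_abs_ne_top {T S : Type*} [MeasurableSpace S]
    {n : Measure S} {V : T → S → ℝ} {ν : Measure (T → ℝ)} (hV : IsLevyRepresentation n V ν)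
    (hν : IsLevyMeasure ν) (t : T) {ε : ℝ} (hε : 0 < ε) : n {s | ε < |V t s|} ≠ ∞ := by
  classical
  let t' : ({t} : Finset T) := ⟨t, by simp⟩
  have h := hV.measure_eq {t} (by simp) {y | ε < |y t'|}
    (measurableSet_lt measurable_const (by fun_prop)) (by simp [hε.le])
  have h' : n {s | ε < |V t s|} = ν {x | ε < |x t|} := h
  have hc : ENNReal.ofReal (min (ε ^ 2) 1) ≠ 0 :=
    (ENNReal.ofReal_pos.2 (lt_min (by positivity) one_pos)).ne'
  have hm : AEMeasurable (fun x : T → ℝ => ENNReal.ofReal (min (|x t| ^ 2) 1)) ν := by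
    refine Measurable.aemeasurable ?_
    fun_prop
  have hsub : {x : T → ℝ | ε < |x t|}
      ⊆ {x | ENNReal.ofReal (min (ε ^ 2) 1) ≤ ENNReal.ofReal (min (|x t| ^ 2) 1)} := by
    intro x hx
    have hx' : ε < |x t| := hx
    change ENNReal.ofReal _ ≤ ENNReal.ofReal _
    gcongr
  rw [h']
  exact ne_top_of_le_ne_top (ENNReal.div_lt_top (hν.lintegral_lt_top t).ne hc).ne
    ((measure_mono hsub).trans (meas_ge_le_lintegral_div hm hc ENNReal.ofReal_ne_top))

/-! ### From nonnegative to real functionals -/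

/-- If the images of `a μ` under `U` and of `c ν` under `W` have the same integrals of nonnegative
functionals, then they are equal, so integrability and integrals of real functionals agree. -/
theorem integrable_iff_and_integral_eq_of_lintegral_eq {α β E : Type*} [MeasurableSpace α]
    [MeasurableSpace β] [MeasurableSpace E] {μ : Measure α} {ν : Measure β} {U : α → E} {W : β → E}
    (hU : Measurable U) (hW : Measurable W) {a : α → ℝ≥0∞} {c : β → ℝ≥0∞} (ha : Measurable a)
    (hc : Measurable c) (ha' : ∀ᵐ x ∂μ, a x < ∞) (hc' : ∀ᵐ y ∂ν, c y < ∞)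
    (h : ∀ F : E → ℝ≥0∞, Measurable F →
      ∫⁻ x, F (U x) * a x ∂μ = ∫⁻ y, F (W y) * c y ∂ν) {F : E → ℝ} (hF : Measurable F) :
    (Integrable (fun x => F (U x) * (a x).toReal) μ ↔
        Integrable (fun y => F (W y) * (c y).toReal) ν) ∧
      ∫ x, F (U x) * (a x).toReal ∂μ = ∫ y, F (W y) * (c y).toReal ∂ν := by
  have hmap : (μ.withDensity a).map U = (ν.withDensity c).map W := by
    refine Measure.ext_of_lintegral _ fun F hF => ?_
    have hFU : Measurable fun x => F (U x) := hF.comp hU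
    have hFW : Measurable fun y => F (W y) := hF.comp hW
    rw [lintegral_map hF hU, lintegral_map hF hW,
      lintegral_withDensity_eq_lintegral_mul _ ha hFU,
      lintegral_withDensity_eq_lintegral_mul _ hc hFW]
    simpa only [Pi.mul_apply, mul_comm] using h F hF
  have hi := integrable_map_measure (μ := μ.withDensity a) hF.aestronglyMeasurable hU.aemeasurable
  have hi' := integrable_map_measure (μ := ν.withDensity c) hF.aestronglyMeasurable hW.aemeasurable
  have he := integral_map (μ := μ.withDensity a) hU.aemeasurable hF.aestronglyMeasurable
  have he' := integral_map (μ := ν.withDensity c) hW.aemeasurable hF.aestronglyMeasurable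
  rw [hmap] at hi he
  have hi2 := hi.symm.trans hi'
  have he2 := he.symm.trans he'
  rw [integrable_withDensity_iff_integrable_smul' ha ha',
    integrable_withDensity_iff_integrable_smul' hc hc'] at hi2
  rw [integral_withDensity_eq_integral_toReal_smul ha ha',
    integral_withDensity_eq_integral_toReal_smul hc hc'] at he2
  simp only [smul_eq_mul, Function.comp_apply, mul_comm] at hi2 he2 ⊢
  exact ⟨hi2, he2⟩

/-! ### The shift identities -/

theorem IsPoissonRandomMeasure.measurable_poissonSum {Ω S : Type*} [MeasurableSpace Ω]
    [MeasurableSpace S] {P : Measure Ω} {n : Measure S} {N : Ω → Measure S}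
    (hN : IsPoissonRandomMeasure P n N) {q : S → ℝ≥0} (hq : Measurable q) :
    Measurable (poissonSum N q) :=
  (Measure.measurable_lintegral hq.coe_nnreal_ennreal).comp hN.measurable

/-- Mecke's formula in terms of the process: inserting an atom at `s` changes the pair `(X, N(q))`
into `(X + V(s), N(q) + q(s))`. -/
theorem IsPoissonRandomMeasure.lintegral_shift {Ω S T : Type*} [MeasurableSpace Ω]
    [MeasurableSpace S] {P : Measure Ω} [IsProbabilityMeasure P] {n : Measure S} [SigmaFinite n]
    {N : Ω → Measure S} (hN : IsPoissonRandomMeasure P n N)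
    {χ : ℝ → ℝ} {V : T → S → ℝ} (hV : ∀ t, Measurable (V t))
    (hn : ∀ t, ∀ ε : ℝ, 0 < ε → n {s | ε < |V t s|} ≠ ∞)
    {G : T → Ω → ℝ} (hG : ∀ t, Measurable (G t)) (hGN : IndepFun (fun ω t => G t ω) N P)
    {b : T → ℝ} {Y : T → Ω → ℝ} (hY : ∀ t, IsCompensatedIntegral P n N χ (V t) (Y t))
    {X : T → Ω → ℝ} (hX : ∀ t, ∀ᵐ ω ∂P, X t ω = G t ω + Y t ω + b t)
    {q : S → ℝ≥0} (hq : Measurable q) {H : (T → ℝ) × ℝ≥0∞ → ℝ≥0∞} (hH : Measurable H) :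
    ∫⁻ ω, H (fun t => X t ω, poissonSum N q ω) * poissonSum N q ω ∂P
      = ∫⁻ s, (∫⁻ ω, H (fun t => X t ω + V t s, poissonSum N q ω + q s) ∂P) * q s ∂n := by
  choose Λ hΛ hΛN hΛδ using fun t => (hY t).exists_functional hN (hV t) (hn t)
  have hq' : Measurable fun s => (q s : ℝ≥0∞) := hq.coe_nnreal_ennreal
  let f : (T → ℝ) × Measure S → ℝ≥0∞ := fun p =>
    H (fun t => p.1 t + Λ t p.2 + b t, ∫⁻ s, (q s : ℝ≥0∞) ∂p.2)
  have hf : Measurable f := by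
    refine hH.comp (Measurable.prodMk (measurable_pi_iff.2 fun t => ?_)
      ((Measure.measurable_lintegral hq').comp measurable_snd))
    exact ((measurable_pi_apply t |>.comp measurable_fst).add
      ((hΛ t).comp measurable_snd)).add_const _
  have hmecke := hN.mecke_indep (measurable_pi_iff.2 hG) hGN hf hq'
  calc _ = ∫⁻ ω, f (fun t => G t ω, N ω) * ∫⁻ s, (q s : ℝ≥0∞) ∂(N ω) ∂P := by
        refine lintegral_congr_ae ?_
        have h := ae_eq_comp_of_forall_ae_eq (P := P) (X := fun ω t => X t ω)
          (X' := fun ω t => G t ω + Λ t (N ω) + b t) (fun t => by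
            filter_upwards [hX t, hΛN t] with ω h1 h2
            rw [h1, h2]) (poissonSum N q) hH
        filter_upwards [h] with ω hω
        rw [hω]
        rfl
    _ = _ := hmecke
    _ = _ := by
        refine lintegral_congr fun s => congrArg (· * (q s : ℝ≥0∞)) (lintegral_congr_ae ?_)
        have h := ae_eq_comp_of_forall_ae_eq (P := P) (X := fun ω t => X t ω + V t s)
          (X' := fun ω t => G t ω + Λ t (N ω + Measure.dirac s) + b t) (fun t => by
            filter_upwards [hX t, hΛδ t] with ω h1 h2
            rw [h1, h2 s]
            ring) (fun ω => poissonSum N q ω + q s) hH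
        filter_upwards [h] with ω hω
        rw [hω]
        simp only [f, poissonSum, lintegral_add_measure, lintegral_dirac' s hq']

theorem IsPoissonRandomMeasure.ae_poissonSum_lt_top {Ω S : Type*} [MeasurableSpace Ω]
    [MeasurableSpace S] {P : Measure Ω} [IsProbabilityMeasure P] {n : Measure S} [SigmaFinite n]
    {N : Ω → Measure S} (hN : IsPoissonRandomMeasure P n N) {q : S → ℝ≥0} (hq : Measurable q)
    (hq1 : ∫⁻ s, (q s : ℝ≥0∞) ∂n ≠ ∞) : ∀ᵐ ω ∂P, poissonSum N q ω < ∞ := by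
  refine ae_lt_top (hN.measurable_poissonSum hq) ?_
  have h := hN.lintegral_lintegral hq.coe_nnreal_ennreal
  unfold poissonSum
  rwa [h]

theorem IsPoissonRandomMeasure.ae_poissonSum_pos {Ω S : Type*} [MeasurableSpace Ω]
    [MeasurableSpace S] {P : Measure Ω} {n : Measure S}
    {N : Ω → Measure S} (hN : IsPoissonRandomMeasure P n N) {q : S → ℝ≥0} (hq : Measurable q)
    (hn : n {s | 0 < q s} = ∞) : ∀ᵐ ω ∂P, 0 < poissonSum N q ω := by
  filter_upwards [hN.eq_top _ (measurableSet_lt measurable_const hq) hn] with ω hω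
  refine pos_iff_ne_zero.2 fun h0 => ?_
  have h1 := measure_eq_zero_iff_ae_notMem.2 (((lintegral_eq_zero_iff
    hq.coe_nnreal_ennreal).1 h0).mono fun s hs => show s ∉ {s | 0 < q s} by
      have : (q s : ℝ≥0∞) = 0 := hs
      simpa using this)
  simp [h1] at hω

theorem theoremt
    {Ω S T : Type*} [MeasurableSpace Ω] [MeasurableSpace S]
    (P : Measure Ω) [IsProbabilityMeasure P]
    (n : Measure S) [SigmaFinite n]
    (χ : ℝ → ℝ) (hχ : IsCutoff χ)
    -- the Lévy measure and its representation `V`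
    (ν : Measure (T → ℝ)) (hν : IsLevyMeasure ν)
    (V : T → S → ℝ) (hV : IsLevyRepresentation n V ν)
    -- the Poisson random measure and the centered Gaussian process
    (N : Ω → Measure S) (hN : IsPoissonRandomMeasure P n N)
    (G : T → Ω → ℝ) (hGm : ∀ t, Measurable (G t)) (hG : IsGaussianProcess G P)
    (hG0 : ∀ t, ∫ ω, G t ω ∂P = 0)
    (hGN : IndepFun (fun ω t => G t ω) N P)
    (b : T → ℝ)
    -- the process `X_t = G_t + Y_t + b(t)` a.s., with `Y_t = ∫ V_t (dN - χ(V_t) dn)`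
    (Y : T → Ω → ℝ) (hY : ∀ t, IsCompensatedIntegral P n N χ (V t) (Y t))
    (X : T → Ω → ℝ) (hXm : ∀ t, Measurable (X t))
    (hX : ∀ t, ∀ᵐ ω ∂P, X t ω = G t ω + Y t ω + b t)
    -- the density `q`
    (q : S → ℝ≥0) (hq : Measurable q) (hq1 : ∫⁻ s, (q s : ℝ≥0∞) ∂n = 1) :
    -- the identities for nonnegative functionals, with values in `[0, ∞]`
    (∀ F : (T → ℝ) → ℝ≥0∞, Measurable F →
      (∫⁻ s, (∫⁻ ω, F (fun t => X t ω + V t s) ∂P) * q s ∂n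
          = ∫⁻ ω, F (fun t => X t ω) * poissonSum N q ω ∂P) ∧
      (∫⁻ ω in {ω | 0 < poissonSum N q ω}, F (fun t => X t ω) ∂P
          = ∫⁻ s, (∫⁻ ω, F (fun t => X t ω + V t s) * (poissonSum N q ω + q s)⁻¹ ∂P) * q s ∂n) ∧
      (n {s | 0 < q s} = ∞ →
        ∫⁻ ω, F (fun t => X t ω) ∂P
          = ∫⁻ s, (∫⁻ ω, F (fun t => X t ω + V t s) * (poissonSum N q ω + q s)⁻¹ ∂P) * q s ∂n)) ∧
    -- the identities for real functionals: one side exists iff the other does, and they are equal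
    (∀ F : (T → ℝ) → ℝ, Measurable F →
      ((Integrable (fun p : S × Ω => F (fun t => X t p.2 + V t p.1) * (q p.1 : ℝ)) (n.prod P) ↔
          Integrable (fun ω => F (fun t => X t ω) * (poissonSum N q ω).toReal) P) ∧
        (Integrable (fun ω => F (fun t => X t ω) * (poissonSum N q ω).toReal) P →
          ∫ s, (∫ ω, F (fun t => X t ω + V t s) ∂P) * (q s : ℝ) ∂n
            = ∫ ω, F (fun t => X t ω) * (poissonSum N q ω).toReal ∂P)) ∧
      ((IntegrableOn (fun ω => F (fun t => X t ω)) {ω | 0 < poissonSum N q ω} P ↔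
          Integrable (fun p : S × Ω => F (fun t => X t p.2 + V t p.1)
            * ((poissonSum N q p.2 + q p.1).toReal)⁻¹ * (q p.1 : ℝ)) (n.prod P)) ∧
        (IntegrableOn (fun ω => F (fun t => X t ω)) {ω | 0 < poissonSum N q ω} P →
          ∫ ω in {ω | 0 < poissonSum N q ω}, F (fun t => X t ω) ∂P
            = ∫ s, (∫ ω, F (fun t => X t ω + V t s)
                * ((poissonSum N q ω + q s).toReal)⁻¹ ∂P) * (q s : ℝ) ∂n)) ∧
      (n {s | 0 < q s} = ∞ →
        (Integrable (fun ω => F (fun t => X t ω)) P ↔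
          Integrable (fun p : S × Ω => F (fun t => X t p.2 + V t p.1)
            * ((poissonSum N q p.2 + q p.1).toReal)⁻¹ * (q p.1 : ℝ)) (n.prod P)) ∧
        (Integrable (fun ω => F (fun t => X t ω)) P →
          ∫ ω, F (fun t => X t ω) ∂P
            = ∫ s, (∫ ω, F (fun t => X t ω + V t s)
                * ((poissonSum N q ω + q s).toReal)⁻¹ ∂P) * (q s : ℝ) ∂n))) := by
  have hn := fun t (ε : ℝ) (hε : 0 < ε) => hV.measure_lt_abs_ne_top hν t hε
  have hM := hN.measurable_poissonSum hq
  have hMtop := hN.ae_poissonSum_lt_top hq (by simp [hq1])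
  have hq' : Measurable fun s => (q s : ℝ≥0∞) := hq.coe_nnreal_ennreal
  have hXm' : Measurable fun ω t => X t ω := measurable_pi_iff.2 hXm
  have hXV : Measurable fun (p : S × Ω) t => X t p.2 + V t p.1 := measurable_pi_iff.2 fun t =>
    ((hXm t).comp measurable_snd).add ((hV.measurable t).comp measurable_fst)
  have hpos : MeasurableSet {ω | 0 < poissonSum N q ω} := measurableSet_lt measurable_const hM
  have hshift := fun (H : (T → ℝ) × ℝ≥0∞ → ℝ≥0∞) (hH : Measurable H) =>
    hN.lintegral_shift hV.measurable hn hGm hGN hY hX hq hH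
  have h1 : ∀ F : (T → ℝ) → ℝ≥0∞, Measurable F →
      ∫⁻ s, (∫⁻ ω, F (fun t => X t ω + V t s) ∂P) * q s ∂n
        = ∫⁻ ω, F (fun t => X t ω) * poissonSum N q ω ∂P := fun F hF =>
    (hshift (fun p => F p.1) (by fun_prop)).symm
  have h2 : ∀ F : (T → ℝ) → ℝ≥0∞, Measurable F →
      ∫⁻ ω in {ω | 0 < poissonSum N q ω}, F (fun t => X t ω) ∂P
        = ∫⁻ s, (∫⁻ ω, F (fun t => X t ω + V t s) * (poissonSum N q ω + q s)⁻¹ ∂P) * q s ∂n := by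
    intro F hF
    rw [← hshift (fun p => F p.1 * p.2⁻¹) (by fun_prop), ← lintegral_indicator hpos]
    refine lintegral_congr_ae ?_
    filter_upwards [hMtop] with ω hω
    -- on `{N(q) = 0}` the integrand is `F(X) * ∞ * 0 = 0`
    rcases eq_or_ne (poissonSum N q ω) 0 with h0 | h0
    · simp [h0]
    · rw [Set.indicator_of_mem (by exact pos_iff_ne_zero.2 h0), mul_assoc,
        ENNReal.inv_mul_cancel h0 hω.ne, mul_one]
  have hrestrict : n {s | 0 < q s} = ∞ → P.restrict {ω | 0 < poissonSum N q ω} = P := fun h =>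
    Measure.restrict_eq_self_of_ae_mem (hN.ae_poissonSum_pos hq h)
  let c : S × Ω → ℝ≥0∞ := fun p => (poissonSum N q p.2 + q p.1)⁻¹ * q p.1
  have hqp : Measurable fun p : S × Ω => (q p.1 : ℝ≥0∞) := hq'.comp measurable_fst
  have hMq : Measurable fun p : S × Ω => (poissonSum N q p.2 + q p.1)⁻¹ :=
    ((hM.comp measurable_snd).add hqp).inv
  have hc : Measurable c := hMq.mul hqp
  -- where `q = 0` the inverse may be `∞`, but then the product is `0`
  have hctop : ∀ p, c p < ∞ := by
    intro p
    rcases eq_or_ne (q p.1) 0 with h0 | h0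
    · simp [c, h0]
    · exact ENNReal.mul_lt_top (by simp [h0, pos_iff_ne_zero]) ENNReal.coe_lt_top
  have hcreal : ∀ p, (c p).toReal = ((poissonSum N q p.2 + q p.1).toReal)⁻¹ * (q p.1 : ℝ) := by
    intro p
    simp [c, ENNReal.toReal_mul, ENNReal.toReal_inv]
  have r1 := fun (F : (T → ℝ) → ℝ) (hF : Measurable F) =>
    integrable_iff_and_integral_eq_of_lintegral_eq (μ := n.prod P) (ν := P) hXV hXm' hqp hM
      (ae_of_all _ fun p => ENNReal.coe_lt_top) hMtop (fun F hF => by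
        have hFX : Measurable fun p : S × Ω => F (fun t => X t p.2 + V t p.1) := hF.comp hXV
        refine (lintegral_prod _ (hFX.mul hqp).aemeasurable).trans (Eq.trans ?_ (h1 F hF))
        simp only [Pi.mul_apply]
        exact lintegral_congr fun s => lintegral_mul_const' _ _ ENNReal.coe_ne_top) hF
  have r2 := fun (F : (T → ℝ) → ℝ) (hF : Measurable F) =>
    integrable_iff_and_integral_eq_of_lintegral_eq
      (μ := P.restrict {ω | 0 < poissonSum N q ω}) (ν := n.prod P) hXm' hXV
      (a := fun _ => 1) measurable_const hc
      (ae_of_all _ fun _ => ENNReal.one_lt_top) (ae_of_all _ hctop) (fun F hF => by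
        have hFX : Measurable fun p : S × Ω => F (fun t => X t p.2 + V t p.1) := hF.comp hXV
        refine Eq.trans ?_ (lintegral_prod _ (hFX.mul hc).aemeasurable).symm
        simp only [mul_one, h2 F hF, Pi.mul_apply, c, ← mul_assoc]
        exact lintegral_congr fun s => (lintegral_mul_const' _ _ ENNReal.coe_ne_top).symm) hF
  simp only [ENNReal.coe_toReal] at r1
  simp only [ENNReal.toReal_one, mul_one, hcreal, ← mul_assoc] at r2
  have r2' : ∀ F : (T → ℝ) → ℝ, Measurable F →
      (IntegrableOn (fun ω => F (fun t => X t ω)) {ω | 0 < poissonSum N q ω} P ↔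
        Integrable (fun p : S × Ω => F (fun t => X t p.2 + V t p.1)
          * ((poissonSum N q p.2 + q p.1).toReal)⁻¹ * (q p.1 : ℝ)) (n.prod P)) ∧
      (IntegrableOn (fun ω => F (fun t => X t ω)) {ω | 0 < poissonSum N q ω} P →
        ∫ ω in {ω | 0 < poissonSum N q ω}, F (fun t => X t ω) ∂P
          = ∫ s, (∫ ω, F (fun t => X t ω + V t s)
              * ((poissonSum N q ω + q s).toReal)⁻¹ ∂P) * (q s : ℝ) ∂n) := by
    intro F hF
    obtain ⟨hi, he⟩ := r2 F hF
    refine ⟨hi, fun h => ?_⟩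
    rw [he, integral_prod _ (hi.1 h)]
    simp only [integral_mul_const]
  refine ⟨fun F hF => ⟨h1 F hF, h2 F hF, fun h => ?_⟩,
    fun F hF => ⟨⟨(r1 F hF).1, fun h => ?_⟩, r2' F hF, fun h => ?_⟩⟩
  · rw [← h2 F hF, hrestrict h]
  · rw [← (r1 F hF).2, integral_prod _ ((r1 F hF).1.2 h)]
    simp only [integral_mul_const]
  · have := r2' F hF
    rwa [IntegrableOn, hrestrict h] at this
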